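/- Let $\hbar>0$, let $\kappa$ be a Borel probability measure on $\mathbb R$, and let $X$ be the position operator on $L^2(\mathbb R)$ (so $e^{ipX/\hbar}$ is multiplication by $x\mapsto e^{ipx/\hbar}$). Define the position-dephasing channel $$\Delta_g(\rho)=\int_{\mathbb R} e^{\frac{i}{\hbar}pX}\,\rho\,e^{-\frac{i}{\hbar}pX}\,d\kappa(p),\qquad g(\xi)=\int_{\mathbb R}e^{\frac{i}{\hbar}p\xi}\,d\kappa(p),$$ so that $\Delta_g$ multiplies the position kernel $\rho(x,y)$ by $g(x-y)$. A normal state is a positive trace-class operator $\rho$ on $L^2(\mathbb R)$ with $\operatorname{Tr}\rho=1$. For normal states $\rho=\sum_a aP_a$ and $\sigma=\sum_b bQ_b$ (spectral decompositions) let $$S(\rho\Vert\sigma)=\operatorname{Tr}\big(\rho(\ln\rho-\ln\sigma)\big)=\sum_{a,b}\operatorname{Tr}(P_aQ_b)\,a(\ln a-\ln b)\in(-\infty,+\infty]$$ be the quantum relative entropy (with $0(\ln 0-\ln b)=0$ and $a(\ln a-\ln 0)=+\infty$ for $a>0$; the negative part of the sum is finite), and let $C_{\mathrm{rel}}^{g}(\rho)=S(\rho\Vert\Delta_g(\rho))$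 be the relative-entropy $g$-dephasing loss. Then $C_{\mathrm{rel}}^{g}(\rho)\ge 0$ for every normal state $\rho$. Furthermore, if $|g(\xi)|<1$ for all $\xi\neq 0$, then no normal state $\rho$ satisfies $C_{\mathrm{rel}}^{g}(\rho)=0$. -/

import Mathlib

open MeasureTheory Filter Topology
open scoped ENNReal InnerProductSpace

noncomputable section

namespace QuantumCoherence

/-! ### Trace of positive operators, density operators, relative entropy -/

/-- Parseval's identity. -/
theorem tsum_inner_sq {H : Type*} [NormedAddCommGroup H] [InnerProductSpace ℂ H] {ι : Type*}
    (b : HilbertBasis ι ℂ H) (x : H) :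
    ∑' i, ENNReal.ofReal (‖⟪b i, x⟫_ℂ‖ ^ 2) = ENNReal.ofReal (‖x‖ ^ 2) := by
  have h := b.hasSum_inner_mul_inner x x
  have h2 : HasSum (fun i => ‖⟪b i, x⟫_ℂ‖ ^ 2) (‖x‖ ^ 2) := by
    have h3 := Complex.hasSum_re h
    convert h3 using 1
    · funext i
      rw [← inner_conj_symm x (b i), ← Complex.normSq_eq_norm_sq, mul_comm, Complex.mul_conj]
      simp
    · rw [← RCLike.re_to_complex, inner_self_eq_norm_sq (𝕜 := ℂ)]
  rw [← ENNReal.ofReal_tsum_of_nonneg (fun i => by positivity) h2.summable, h2.tsum_eq]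

section Hilbert

variable {H : Type*} [NormedAddCommGroup H] [InnerProductSpace ℂ H] [CompleteSpace H]

/-- An index set of a Hilbert basis (a complete orthonormal system) of `H`. -/
def basisIndex (H : Type*) [NormedAddCommGroup H] [InnerProductSpace ℂ H] [CompleteSpace H] :
    Set H :=
  (exists_hilbertBasis ℂ H).choose

/-- A Hilbert basis (a complete orthonormal system) of `H`. -/
def someBasis (H : Type*) [NormedAddCommGroup H] [InnerProductSpace ℂ H] [CompleteSpace H] :
    HilbertBasis (basisIndex H) ℂ H :=
  (exists_hilbertBasis ℂ H).choose_spec.choose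

/-- The trace `∑ᵢ ⟨bᵢ, T bᵢ⟩ ∈ [0, ∞]` of a positive operator `T`, computed in some Hilbert
basis; `posTrace_eq` shows that the basis does not matter. -/
def posTrace (T : H →L[ℂ] H) : ℝ≥0∞ :=
  ∑' i, ENNReal.ofReal (⟪someBasis H i, T (someBasis H i)⟫_ℂ).re

/-- The trace of a positive operator may be computed in any Hilbert basis. -/
theorem posTrace_eq {ι : Type*} (b : HilbertBasis ι ℂ H) {T : H →L[ℂ] H} (hT : T.IsPositive) :
    posTrace T = ∑' i, ENNReal.ofReal (⟪b i, T (b i)⟫_ℂ).re := by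
  obtain ⟨S, hS, hST⟩ : ∃ S : H →L[ℂ] H, IsSelfAdjoint S ∧ S * S = T := by
    have hT0 : 0 ≤ T := T.nonneg_iff_isPositive.2 hT
    exact ⟨CFC.sqrt T, (CFC.sqrt_nonneg T).isSelfAdjoint, CFC.sqrt_mul_sqrt_self T hT0⟩
  have hsym : ∀ x y : H, ⟪S x, y⟫_ℂ = ⟪x, S y⟫_ℂ := fun x y => hS.isSymmetric x y
  have key : ∀ x : H, (⟪x, T x⟫_ℂ).re = ‖S x‖ ^ 2 := by
    intro x
    rw [← hST, show (S * S) x = S (S x) from rfl, ← hsym, ← RCLike.re_to_complex,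
      inner_self_eq_norm_sq (𝕜 := ℂ)]
  simp only [posTrace, key]
  calc ∑' i, ENNReal.ofReal (‖S (someBasis H i)‖ ^ 2)
      = ∑' i, ∑' j, ENNReal.ofReal (‖⟪b j, S (someBasis H i)⟫_ℂ‖ ^ 2) := by
        simp only [tsum_inner_sq]
    _ = ∑' j, ∑' i, ENNReal.ofReal (‖⟪b j, S (someBasis H i)⟫_ℂ‖ ^ 2) := ENNReal.tsum_comm
    _ = ∑' j, ∑' i, ENNReal.ofReal (‖⟪someBasis H i, S (b j)⟫_ℂ‖ ^ 2) := by
        simp only [← hsym, norm_inner_symm]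
    _ = ∑' j, ENNReal.ofReal (‖S (b j)‖ ^ 2) := by
        simp only [tsum_inner_sq]

/-- A normal state (density operator): a positive operator of trace one. A positive operator is
trace class exactly when its trace is finite, so it is in particular trace class. -/
def IsNormalState (ρ : H →L[ℂ] H) : Prop :=
  ρ.IsPositive ∧ posTrace ρ = 1

/-- The spectral projection of `T` at `a`: the orthogonal projection onto `ker (T - a)`, which is
zero unless `a` is an eigenvalue of `T`. -/
def eigenProj (T : H →L[ℂ] H) (a : ℝ) : H →L[ℂ] H :=
  (T - (a : ℂ) • ContinuousLinearMap.id ℂ H).ker.starProjection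

/-- `Tr (P_a Q_b)`, where `P_a` and `Q_b` are the spectral projections of `ρ` at `a` and of `σ`
at `b`, written as the trace of the positive operator `P_a Q_b P_a`. -/
def spectralOverlap (ρ σ : H →L[ℂ] H) (a b : ℝ) : ℝ≥0∞ :=
  posTrace (eigenProj ρ a ∘L eigenProj σ b ∘L eigenProj ρ a)

/-- `a (ln a - ln b)` for `a, b ≥ 0`, with the conventions `0 (ln 0 - ln b) = 0` and
`a (ln a - ln 0) = +∞` for `a > 0`. -/
def entropyTerm (a b : ℝ) : EReal :=
  if a = 0 then 0 else if b = 0 then ⊤ else ((a * (Real.log a - Real.log b) : ℝ) : EReal)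

/-- The quantum relative entropy `S(ρ‖σ) = Tr (ρ (ln ρ - ln σ))` of two normal states. With the
spectral decompositions `ρ = ∑ₐ a P_a` and `σ = ∑_b b Q_b`, this trace is
`∑_{a, b} Tr (P_a Q_b) a (ln a - ln b)`, the sum of the positive parts minus the sum of the negative
parts (the latter is finite, at most `Tr σ`). The value is `+∞` in particular if the support of `ρ`
is not contained in that of `σ`. -/
def relativeEntropy (ρ σ : H →L[ℂ] H) : EReal :=
  ((∑' (a : ℝ) (b : ℝ), spectralOverlap ρ σ a b * (entropyTerm a b).toENNReal : ℝ≥0∞) : EReal) -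
    ((∑' (a : ℝ) (b : ℝ), spectralOverlap ρ σ a b * (-entropyTerm a b).toENNReal : ℝ≥0∞) : EReal)

end Hilbert

/-! ### Position dephasing by random momentum kicks on `L²(ℝ)` -/

/-- The Hilbert space `L²(ℝ)` of complex square-integrable wave functions. -/
abbrev L2R : Type := Lp ℂ 2 (volume : Measure ℝ)

/-- The phase `e^{i p x / ħ}`. -/
def phase (ħ p x : ℝ) : ℂ := Complex.exp (((p * x / ħ : ℝ) : ℂ) * Complex.I)

theorem norm_phase (ħ p x : ℝ) : ‖phase ħ p x‖ = 1 := Complex.norm_exp_ofReal_mul_I _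

theorem memLp_phase_mul (ħ p : ℝ) (ψ : L2R) :
    MemLp (fun x => phase ħ p x * ψ x) 2 (volume : Measure ℝ) := by
  refine (Lp.memLp ψ).of_le ?_ (Eventually.of_forall fun x => by simp [norm_phase])
  refine AEStronglyMeasurable.mul ?_ (Lp.aestronglyMeasurable ψ)
  exact Continuous.aestronglyMeasurable (by unfold phase; fun_prop)

/-- The unitary `e^{i p X / ħ}` on `L²(ℝ)`, where `X` is the position operator:
multiplication of wave functions by `x ↦ e^{i p x / ħ}`. -/
def momentumKick (ħ p : ℝ) : L2R →ₗᵢ[ℂ] L2R where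
  toFun ψ := (memLp_phase_mul ħ p ψ).toLp _
  map_add' ψ φ := by
    rw [← MemLp.toLp_add]
    apply MemLp.toLp_congr
    filter_upwards [Lp.coeFn_add ψ φ] with x hx
    rw [hx, Pi.add_apply, Pi.add_apply, mul_add]
  map_smul' c ψ := by
    rw [RingHom.id_apply, ← MemLp.toLp_const_smul]
    apply MemLp.toLp_congr
    filter_upwards [Lp.coeFn_smul c ψ] with x hx
    rw [hx, Pi.smul_apply, Pi.smul_apply, smul_eq_mul, smul_eq_mul, mul_left_comm]
  norm_map' ψ := by
    change ‖(memLp_phase_mul ħ p ψ).toLp _‖ = ‖ψ‖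
    rw [Lp.norm_toLp, Lp.norm_def]
    congr 1
    exact eLpNorm_congr_norm_ae (Eventually.of_forall fun x => by simp [norm_phase])

theorem momentumKick_coeFn (ħ p : ℝ) (ψ : L2R) :
    momentumKick ħ p ψ =ᵐ[volume] fun x => phase ħ p x * ψ x :=
  MemLp.coeFn_toLp (memLp_phase_mul ħ p ψ)

theorem continuous_momentumKick (ħ : ℝ) (ψ : L2R) : Continuous fun p => momentumKick ħ p ψ := by
  rw [continuous_iff_continuousAt]
  intro q
  rw [ContinuousAt, Lp.tendsto_Lp_iff_tendsto_eLpNorm']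
  have h1 : ∀ p, eLpNorm (⇑(momentumKick ħ p ψ) - ⇑(momentumKick ħ q ψ)) 2 volume =
      (∫⁻ x, ‖(phase ħ p x - phase ħ q x) * ψ x‖ₑ ^ (2 : ℝ)) ^ (1 / (2 : ℝ)) := by
    intro p
    rw [eLpNorm_congr_ae (g := fun x => (phase ħ p x - phase ħ q x) * ψ x),
      eLpNorm_eq_lintegral_rpow_enorm_toReal (by norm_num) (by norm_num)]
    · simp
    · filter_upwards [momentumKick_coeFn ħ p ψ, momentumKick_coeFn ħ q ψ] with x h h'
      simp [h, h', sub_mul]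
  simp only [h1]
  have h2 : Tendsto (fun p => ∫⁻ x, ‖(phase ħ p x - phase ħ q x) * ψ x‖ₑ ^ (2 : ℝ)) (𝓝 q)
      (𝓝 (∫⁻ _ : ℝ, 0)) := by
    refine tendsto_lintegral_filter_of_dominated_convergence
      (fun x => (2 * ‖ψ x‖ₑ) ^ (2 : ℝ)) ?_ ?_ ?_ ?_
    · refine Eventually.of_forall fun p => ?_
      have hm : Measurable (ψ : ℝ → ℂ) := (Lp.stronglyMeasurable ψ).measurable
      have hp : ∀ r, Measurable (phase ħ r) := fun r =>
        Continuous.measurable (by unfold phase; fun_prop)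
      exact ((((hp p).sub (hp q)).mul hm).enorm).pow_const _
    · refine Eventually.of_forall fun p => Eventually.of_forall fun x => ?_
      rw [enorm_mul]
      gcongr
      refine (enorm_sub_le).trans ?_
      have : ∀ r, ‖phase ħ r x‖ₑ = 1 := fun r => by
        rw [← ofReal_norm, norm_phase, ENNReal.ofReal_one]
      rw [this, this]; norm_num
    · have h := (Lp.memLp ψ).2
      have h3 := lintegral_rpow_enorm_lt_top_of_eLpNorm_lt_top (by norm_num) (by norm_num) h
      simp only [ENNReal.mul_rpow_of_nonneg _ _ (zero_le_two : (0 : ℝ) ≤ 2)]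
      rw [lintegral_const_mul' _ _ (by finiteness)]
      exact ENNReal.mul_ne_top (by finiteness) (by simpa using h3.ne)
    · refine Eventually.of_forall fun x => ?_
      have hc : Continuous fun p => ‖(phase ħ p x - phase ħ q x) * ψ x‖ₑ ^ (2 : ℝ) := by
        have : Continuous fun p => phase ħ p x := by unfold phase; fun_prop
        refine (ENNReal.continuous_rpow_const).comp ?_
        fun_prop
      simpa using hc.tendsto q
  have h4 := (ENNReal.continuous_rpow_const (y := 1 / (2 : ℝ))).tendsto _ |>.comp h2
  simpa [Function.comp_def] using h4

/-- The path `p ↦ e^{i p X / ħ} T e^{- i p X / ħ} ψ` is continuous. -/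
theorem continuous_kicked (ħ : ℝ) (T : L2R →L[ℂ] L2R) (ψ : L2R) :
    Continuous fun p => momentumKick ħ p (T (momentumKick ħ (-p) ψ)) := by
  have hv : Continuous fun p => T (momentumKick ħ (-p) ψ) :=
    T.continuous.comp ((continuous_momentumKick ħ ψ).comp continuous_neg)
  rw [continuous_iff_continuousAt]
  intro q
  have h1 := (continuous_momentumKick ħ (T (momentumKick ħ (-q) ψ))).tendsto q
  have h2 : Tendsto (fun p => momentumKick ħ p
      (T (momentumKick ħ (-p) ψ) - T (momentumKick ħ (-q) ψ))) (𝓝 q) (𝓝 0) := by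
    rw [tendsto_zero_iff_norm_tendsto_zero]
    simp only [LinearIsometry.norm_map]
    rw [← tendsto_zero_iff_norm_tendsto_zero]
    simpa using (hv.tendsto q).sub_const (T (momentumKick ħ (-q) ψ))
  have h3 := h2.add h1
  simpa [ContinuousAt] using h3

theorem integrable_kicked (ħ : ℝ) (κ : Measure ℝ) [IsProbabilityMeasure κ]
    (T : L2R →L[ℂ] L2R) (ψ : L2R) :
    Integrable (fun p => momentumKick ħ p (T (momentumKick ħ (-p) ψ))) κ := by
  refine Integrable.of_bound (continuous_kicked ħ T ψ).aestronglyMeasurable (‖T‖ * ‖ψ‖)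
    (Eventually.of_forall fun p => ?_)
  rw [LinearIsometry.norm_map]
  exact (T.le_opNorm _).trans (by rw [LinearIsometry.norm_map])

/-- The position-dephasing channel
`Δ(T) = ∫ e^{i p X / ħ} T e^{- i p X / ħ} dκ(p)`
of random momentum kicks `p` with distribution `κ` (the integral is taken in the strong operator
topology). -/
def dephasing (ħ : ℝ) (κ : Measure ℝ) [IsProbabilityMeasure κ] (T : L2R →L[ℂ] L2R) :
    L2R →L[ℂ] L2R :=
  LinearMap.mkContinuous
    { toFun := fun ψ => ∫ p, momentumKick ħ p (T (momentumKick ħ (-p) ψ)) ∂κ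
      map_add' := fun ψ φ => by
        simp only [map_add]
        exact integral_add (integrable_kicked ħ κ T ψ) (integrable_kicked ħ κ T φ)
      map_smul' := fun c ψ => by
        simp only [map_smul, RingHom.id_apply]
        exact integral_smul c _ }
    ‖T‖ (fun ψ => by
      refine (norm_integral_le_of_norm_le_const (C := ‖T‖ * ‖ψ‖)
        (Eventually.of_forall fun p => ?_)).trans (by simp)
      rw [LinearIsometry.norm_map]
      exact (T.le_opNorm _).trans (by rw [LinearIsometry.norm_map]))

/-- The dephasing function `g(ξ) = ∫ e^{i p ξ / ħ} dκ(p)`. -/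
def dephasingFunction (ħ : ℝ) (κ : Measure ℝ) (ξ : ℝ) : ℂ := ∫ p, phase ħ p ξ ∂κ

/-- The relative-entropy `g`-dephasing loss `S(ρ ‖ Δ_g(ρ))`, with values in `[-∞, +∞]`. -/
def relEntropyLoss (ħ : ℝ) (κ : Measure ℝ) [IsProbabilityMeasure κ] (ρ : L2R →L[ℂ] L2R) : EReal :=
  relativeEntropy ρ (dephasing ħ κ ρ)

end QuantumCoherence

end

/-!
Let `P_a` and `Q_b` be the spectral projections of two states `ρ` and `σ`. The weights
`a Tr (P_a Q_b)` and `b Tr (P_a Q_b)` have total mass `Tr ρ` and `Tr σ`, and `S(ρ‖σ)` is their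
classical relative entropy. Summing `a - b ≤ a (ln a - ln b)`, an equality only for `a = b`, gives
`S(ρ‖σ) ≥ 0`; if `S(ρ‖σ) = 0`, then `P_a Q_b = 0` for `a ≠ b`, that is, `ρ = σ`.

Now let `Δ(ρ) = ρ`, and let `E` be the eigenspace of `ρ` for the eigenvalue `‖ρ‖`, which is finite
dimensional and nonzero. For `ψ` in `E`, the number `⟨ψ, ρ ψ⟩ = ‖ρ‖ ‖ψ‖²` is the average over `p`
of `⟨φ, ρ φ⟩ ≤ ‖ρ‖ ‖ψ‖²` with `φ = e^{-ipX/ħ} ψ`, so `φ` lies in `E` for almost every `p`. Hence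
almost every `e^{-ipX/ħ}` preserves `E` and has an eigenvector there. Multiplication by
`x ↦ e^{-ipx/ħ}` has none unless `p = 0`, so `κ` is the Dirac mass at `0` and `g = 1`.
-/

namespace QuantumCoherence

/-! ### Operators of finite trace are compact -/

section HilbertSchmidt

variable {𝕜 ι E F : Type*} [RCLike 𝕜] [NormedAddCommGroup E] [InnerProductSpace 𝕜 E]
  [NormedAddCommGroup F] [NormedSpace 𝕜 F]

theorem opNorm_le_sqrt_of_hasSum_sq_norm (b : HilbertBasis ι 𝕜 E) (S : E →L[𝕜] F) {c : ℝ}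
    (hc : HasSum (fun i => ‖S (b i)‖ ^ 2) c) : ‖S‖ ≤ √c := by
  refine S.opNorm_le_bound (Real.sqrt_nonneg c) fun x => ?_
  have hx : HasSum (fun i => ⟪b i, x⟫_𝕜 • S (b i)) (S x) := by
    simpa [b.repr_apply_apply] using (b.hasSum_repr x).mapL S
  refine le_of_tendsto hx.norm (Eventually.of_forall fun s => ?_)
  calc ‖∑ i ∈ s, ⟪b i, x⟫_𝕜 • S (b i)‖
      ≤ ∑ i ∈ s, ‖S (b i)‖ * ‖⟪b i, x⟫_𝕜‖ :=
        norm_sum_le_of_le s fun i _ => by rw [norm_smul, mul_comm]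
    _ ≤ √(∑ i ∈ s, ‖S (b i)‖ ^ 2) * √(∑ i ∈ s, ‖⟪b i, x⟫_𝕜‖ ^ 2) :=
        Real.sum_mul_le_sqrt_mul_sqrt s _ _
    _ ≤ √c * ‖x‖ := by
        gcongr
        · exact sum_le_hasSum s (fun i _ => by positivity) hc
        · exact Real.sqrt_le_left (norm_nonneg x) |>.2 (b.orthonormal.sum_inner_products_le x)

/-- The finite rank operator that agrees with `S` on the basis vectors `b i` with `i ∈ s` and
vanishes on the others. -/
noncomputable def basisTruncation (b : HilbertBasis ι 𝕜 E) (S : E →L[𝕜] F) (s : Finset ι) :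
    E →L[𝕜] F :=
  ∑ i ∈ s, (innerSL 𝕜 (b i)).smulRight (S (b i))

theorem isCompactOperator_basisTruncation (b : HilbertBasis ι 𝕜 E) (S : E →L[𝕜] F)
    (s : Finset ι) : IsCompactOperator (basisTruncation b S s) :=
  Submodule.sum_mem (compactOperator (RingHom.id 𝕜) E F) fun i _ =>
    (isCompactOperator_of_locallyCompactSpace_dom (innerSL 𝕜 (b i))).clm_comp
      ((ContinuousLinearMap.id 𝕜 𝕜).smulRight (S (b i)))

theorem sub_basisTruncation_apply_basis (b : HilbertBasis ι 𝕜 E) (S : E →L[𝕜] F) (s : Finset ι)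
    (j : ι) : (S - basisTruncation b S s) (b j) = {i | i ∉ s}.indicator (fun i => S (b i)) j := by
  classical
  by_cases hj : j ∈ s <;>
    simp [basisTruncation, sum_apply, orthonormal_iff_ite.1 b.orthonormal, ite_smul, hj]

theorem tendsto_basisTruncation (b : HilbertBasis ι 𝕜 E) (S : E →L[𝕜] F)
    (hS : Summable fun i => ‖S (b i)‖ ^ 2) : Tendsto (basisTruncation b S) atTop (𝓝 S) := by
  have hsum (s : Finset ι) : HasSum (fun i => ‖(S - basisTruncation b S s) (b i)‖ ^ 2)
      (∑' i : { i // i ∉ s }, ‖S (b i)‖ ^ 2) := by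
    have hind : (fun i => ‖(S - basisTruncation b S s) (b i)‖ ^ 2) =
        {i | i ∉ s}.indicator fun i => ‖S (b i)‖ ^ 2 := by
      funext i
      by_cases hi : i ∈ s <;> simp only [sub_basisTruncation_apply_basis] <;> simp [hi]
    rw [hind]
    exact (hasSum_subtype_iff_indicator (s := {i | i ∉ s})).1 (hS.subtype _).hasSum
  have htail : Tendsto (fun s : Finset ι => √(∑' i : { i // i ∉ s }, ‖S (b i)‖ ^ 2)) atTop
      (𝓝 0) := by
    simpa using (tendsto_tsum_compl_atTop_zero fun i => ‖S (b i)‖ ^ 2).sqrt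
  rw [tendsto_iff_norm_sub_tendsto_zero]
  refine squeeze_zero (fun s => norm_nonneg _) (fun s => ?_) htail
  rw [norm_sub_rev]
  exact opNorm_le_sqrt_of_hasSum_sq_norm b _ (hsum s)

theorem isCompactOperator_of_summable_sq_norm [CompleteSpace F] (b : HilbertBasis ι 𝕜 E)
    (S : E →L[𝕜] F) (hS : Summable fun i => ‖S (b i)‖ ^ 2) : IsCompactOperator S :=
  isCompactOperator_of_tendsto (tendsto_basisTruncation b S hS)
    (Eventually.of_forall (isCompactOperator_basisTruncation b S))

end HilbertSchmidt

section Trace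

variable {H : Type*} [NormedAddCommGroup H] [InnerProductSpace ℂ H] [CompleteSpace H]

theorem re_inner_apply_eq_sq_norm_sqrt {T : H →L[ℂ] H} (hT : T.IsPositive) (x : H) :
    (⟪x, T x⟫_ℂ).re = ‖CFC.sqrt T x‖ ^ 2 := by
  have hsq : CFC.sqrt T * CFC.sqrt T = T :=
    CFC.sqrt_mul_sqrt_self T (T.nonneg_iff_isPositive.2 hT)
  have hsymm : (CFC.sqrt T).IsSymmetric := (CFC.sqrt_nonneg T).isSelfAdjoint.isSymmetric
  calc (⟪x, T x⟫_ℂ).re = (⟪x, CFC.sqrt T (CFC.sqrt T x)⟫_ℂ).re := by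
        rw [← mul_apply_eq_comp, hsq]
    _ = (⟪CFC.sqrt T x, CFC.sqrt T x⟫_ℂ).re := congrArg Complex.re (hsymm x _).symm
    _ = ‖CFC.sqrt T x‖ ^ 2 := inner_self_eq_norm_sq (𝕜 := ℂ) _

theorem isCompactOperator_of_posTrace_ne_top {T : H →L[ℂ] H} (hT : T.IsPositive)
    (htr : posTrace T ≠ ⊤) : IsCompactOperator T := by
  have hsummable : Summable fun i => ‖CFC.sqrt T (someBasis H i)‖ ^ 2 := by
    simp only [posTrace, re_inner_apply_eq_sq_norm_sqrt hT] at htr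
    simpa using ENNReal.summable_toReal htr
  have hsqrt := isCompactOperator_of_summable_sq_norm (someBasis H) (CFC.sqrt T) hsummable
  rw [← CFC.sqrt_mul_sqrt_self T (T.nonneg_iff_isPositive.2 hT)]
  exact hsqrt.comp_clm (CFC.sqrt T)

theorem IsNormalState.isCompactOperator {ρ : H →L[ℂ] H} (hρ : IsNormalState ρ) :
    IsCompactOperator ρ :=
  isCompactOperator_of_posTrace_ne_top hρ.1 (by simp [hρ.2])

theorem IsNormalState.ne_zero {ρ : H →L[ℂ] H} (hρ : IsNormalState ρ) : ρ ≠ 0 := by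
  rintro rfl
  simpa [posTrace] using hρ.2

end Trace

/-! ### Spectral decomposition of compact self-adjoint operators -/

section OrthogonalFamily

variable {𝕜 ι E : Type*} [RCLike 𝕜] [NormedAddCommGroup E] [InnerProductSpace 𝕜 E]
  [CompleteSpace E]

theorem hasSum_starProjection_of_orthogonalFamily {V : ι → Submodule 𝕜 E}
    [∀ i, CompleteSpace (V i)] (hV : OrthogonalFamily 𝕜 (fun i => V i) fun i => (V i).subtypeₗᵢ)
    (hdense : (⨆ i, V i).topologicalClosure = ⊤) (x : E) :
    HasSum (fun i => (V i).starProjection x) x := by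
  have hilbertSum := IsHilbertSum.mkInternal V hV hdense.ge
  set w := hilbertSum.linearIsometryEquiv x with hw
  have hx : HasSum (fun i => (w i : E)) x := by
    simpa [hw] using hilbertSum.hasSum_linearIsometryEquiv_symm w
  suffices hproj : ∀ i, (V i).starProjection x = w i by simpa only [hproj] using hx
  intro i
  have hself : (V i).starProjection (w i) = w i :=
    Submodule.starProjection_eq_self_iff.2 (w i).2
  have hother (j : ι) (hj : j ≠ i) : (V i).starProjection (w j) = 0 :=
    (Submodule.starProjection_apply_eq_zero_iff _).2
      (Submodule.isOrtho_iff_le.1 (hV.isOrtho hj) (w j).2)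
  rw [← hself]
  exact (hx.mapL (V i).starProjection).unique (hasSum_single i hother)

end OrthogonalFamily

section EigenProj

variable {H : Type*} [NormedAddCommGroup H] [InnerProductSpace ℂ H]

/-- The space of solutions `x` of `T x = a x` for a real number `a`; its orthogonal projection is
`eigenProj T a`. It is written as a kernel, so that it is visibly closed. -/
abbrev realEigenspace (T : H →L[ℂ] H) (a : ℝ) : Submodule ℂ H :=
  (T - (a : ℂ) • ContinuousLinearMap.id ℂ H).ker

theorem mem_realEigenspace {T : H →L[ℂ] H} {a : ℝ} {x : H} :
    x ∈ realEigenspace T a ↔ T x = (a : ℂ) • x := by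
  simp [sub_eq_zero]

theorem realEigenspace_eq_eigenspace (T : H →L[ℂ] H) (a : ℝ) :
    realEigenspace T a = Module.End.eigenspace (T : Module.End ℂ H) (a : ℂ) := by
  ext x
  rw [mem_realEigenspace, Module.End.mem_eigenspace_iff, ContinuousLinearMap.coe_coe]

theorem orthogonalFamily_realEigenspace {T : H →L[ℂ] H} (hT : T.IsSymmetric) :
    OrthogonalFamily ℂ (fun a => realEigenspace T a) fun a => (realEigenspace T a).subtypeₗᵢ := by
  refine OrthogonalFamily.of_pairwise fun a b hab => ?_
  change realEigenspace T a ⟂ realEigenspace T b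
  rw [realEigenspace_eq_eigenspace, realEigenspace_eq_eigenspace]
  exact hT.orthogonalFamily_eigenspaces.isOrtho (Complex.ofReal_injective.ne hab)

variable [CompleteSpace H]

theorem topologicalClosure_iSup_realEigenspace {T : H →L[ℂ] H} (hc : IsCompactOperator T)
    (hT : T.IsSymmetric) : (⨆ a, realEigenspace T a).topologicalClosure = ⊤ := by
  have hle : ⨆ μ, Module.End.eigenspace (T : Module.End ℂ H) μ ≤ ⨆ a, realEigenspace T a := by
    refine iSup_le fun μ => ?_
    by_cases hμ : Module.End.HasEigenvalue (T : Module.End ℂ H) μ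
    · obtain ⟨a, rfl⟩ := Complex.conj_eq_iff_real.1 (hT.conj_eigenvalue_eq_self hμ)
      exact (realEigenspace_eq_eigenspace T a).ge.trans (le_iSup _ a)
    · rw [Module.End.hasEigenvalue_iff, not_not] at hμ
      exact hμ.le.trans bot_le
  rw [Submodule.topologicalClosure_eq_top_iff, eq_bot_iff,
    ← ContinuousLinearMap.orthogonalComplement_iSup_eigenspaces_eq_bot hc hT]
  exact Submodule.orthogonal_le hle

theorem apply_eigenProj (T : H →L[ℂ] H) (a : ℝ) (x : H) :
    T (eigenProj T a x) = (a : ℂ) • eigenProj T a x :=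
  mem_realEigenspace.1 (Submodule.starProjection_apply_mem _ x)

theorem eigenProj_eq_self_iff {T : H →L[ℂ] H} {a : ℝ} {x : H} :
    eigenProj T a x = x ↔ T x = (a : ℂ) • x :=
  Submodule.starProjection_eq_self_iff.trans mem_realEigenspace

theorem eigenProj_eigenProj_of_ne {T : H →L[ℂ] H} (hT : T.IsSymmetric) {a b : ℝ} (hab : a ≠ b)
    (x : H) : eigenProj T b (eigenProj T a x) = 0 :=
  (Submodule.starProjection_apply_eq_zero_iff _).2 <|
    Submodule.isOrtho_iff_le.1 ((orthogonalFamily_realEigenspace hT).isOrtho hab)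
      (Submodule.starProjection_apply_mem _ x)

theorem inner_eigenProj_left (T : H →L[ℂ] H) (a : ℝ) (x y : H) :
    ⟪eigenProj T a x, y⟫_ℂ = ⟪x, eigenProj T a y⟫_ℂ :=
  Submodule.inner_starProjection_left_eq_right _ x y

theorem re_inner_eigenProj_self (T : H →L[ℂ] H) (a : ℝ) (x : H) :
    (⟪x, eigenProj T a x⟫_ℂ).re = ‖eigenProj T a x‖ ^ 2 := by
  rw [← inner_eigenProj_left]
  exact Submodule.re_inner_starProjection_eq_normSq (K := realEigenspace T a) x

theorem eigenProj_eq_zero_of_neg {T : H →L[ℂ] H} (hT : T.IsPositive) {a : ℝ} (ha : a < 0) :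
    eigenProj T a = 0 := by
  ext x
  have hnonneg : 0 ≤ a * ‖eigenProj T a x‖ ^ 2 := by
    have h := hT.re_inner_nonneg_right (eigenProj T a x)
    rwa [apply_eigenProj, inner_smul_right, RCLike.re_to_complex, Complex.re_ofReal_mul,
      ← RCLike.re_to_complex, inner_self_eq_norm_sq] at h
  have hsq : ‖eigenProj T a x‖ ^ 2 ≤ 0 := nonpos_of_mul_nonneg_right hnonneg ha
  simpa using hsq.antisymm (sq_nonneg _)

theorem hasSum_eigenProj {T : H →L[ℂ] H} (hc : IsCompactOperator T) (hT : T.IsSymmetric) (x : H) :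
    HasSum (fun a => eigenProj T a x) x :=
  hasSum_starProjection_of_orthogonalFamily (orthogonalFamily_realEigenspace hT)
    (topologicalClosure_iSup_realEigenspace hc hT) x

theorem hasSum_sq_norm_eigenProj {T : H →L[ℂ] H} (hc : IsCompactOperator T) (hT : T.IsSymmetric)
    (x : H) : HasSum (fun a => ‖eigenProj T a x‖ ^ 2) (‖x‖ ^ 2) := by
  have h := Complex.hasSum_re ((hasSum_eigenProj hc hT x).mapL (innerSL ℂ x))
  simp only [innerSL_apply_apply, re_inner_eigenProj_self] at h
  rwa [← RCLike.re_to_complex, inner_self_eq_norm_sq] at h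

theorem hasSum_mul_sq_norm_eigenProj {T : H →L[ℂ] H} (hc : IsCompactOperator T)
    (hT : T.IsSymmetric) (x : H) :
    HasSum (fun a => a * ‖eigenProj T a x‖ ^ 2) (⟪x, T x⟫_ℂ).re := by
  have h := Complex.hasSum_re (((hasSum_eigenProj hc hT x).mapL T).mapL (innerSL ℂ x))
  simpa only [innerSL_apply_apply, apply_eigenProj, inner_smul_right, Complex.re_ofReal_mul,
    re_inner_eigenProj_self] using h

theorem tsum_ofReal_sq_norm_eigenProj {T : H →L[ℂ] H} (hc : IsCompactOperator T)
    (hT : T.IsSymmetric) (x : H) :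
    ∑' a : ℝ, ENNReal.ofReal (‖eigenProj T a x‖ ^ 2) = ENNReal.ofReal (‖x‖ ^ 2) := by
  have h := hasSum_sq_norm_eigenProj hc hT x
  rw [← h.tsum_eq, ENNReal.ofReal_tsum_of_nonneg (fun a => by positivity) h.summable]

theorem tsum_ofReal_sq_norm_eigenProj_mul {T : H →L[ℂ] H} (hc : IsCompactOperator T)
    (hT : T.IsPositive) (x : H) :
    ∑' a : ℝ, ENNReal.ofReal (‖eigenProj T a x‖ ^ 2) * ENNReal.ofReal a =
      ENNReal.ofReal (⟪x, T x⟫_ℂ).re := by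
  have h := hasSum_mul_sq_norm_eigenProj hc hT.isSymmetric x
  have hnonneg (a : ℝ) : 0 ≤ a * ‖eigenProj T a x‖ ^ 2 := by
    rcases lt_or_ge a 0 with ha | ha
    · simp [eigenProj_eq_zero_of_neg hT ha]
    · positivity
  rw [← h.tsum_eq, ENNReal.ofReal_tsum_of_nonneg hnonneg h.summable]
  simp only [ENNReal.ofReal_mul' (sq_nonneg _), mul_comm]

end EigenProj

/-! ### Klein's inequality -/

section Overlap

variable {H : Type*} [NormedAddCommGroup H] [InnerProductSpace ℂ H] [CompleteSpace H]

theorem spectralOverlap_eq_tsum (ρ σ : H →L[ℂ] H) (a b : ℝ) :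
    spectralOverlap ρ σ a b =
      ∑' i, ENNReal.ofReal (‖eigenProj σ b (eigenProj ρ a (someBasis H i))‖ ^ 2) := by
  simp only [spectralOverlap, posTrace, ContinuousLinearMap.comp_apply]
  simp only [← inner_eigenProj_left ρ, re_inner_eigenProj_self]

theorem spectralOverlap_comm (ρ σ : H →L[ℂ] H) (a b : ℝ) :
    spectralOverlap ρ σ a b = spectralOverlap σ ρ b a := by
  simp only [spectralOverlap_eq_tsum, ← tsum_inner_sq (someBasis H)]
  rw [ENNReal.tsum_comm]
  congr! 5 with i j
  rw [← inner_eigenProj_left, ← inner_eigenProj_left, norm_inner_symm]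

theorem spectralOverlap_eq_zero_iff {ρ σ : H →L[ℂ] H} {a b : ℝ} :
    spectralOverlap ρ σ a b = 0 ↔ eigenProj σ b ∘L eigenProj ρ a = 0 := by
  rw [spectralOverlap_eq_tsum, ENNReal.tsum_eq_zero]
  refine ⟨fun h => ?_, fun h i => ?_⟩
  · refine ContinuousLinearMap.ext_on
      (Submodule.dense_iff_topologicalClosure_eq_top.2 (someBasis H).dense_span) ?_
    rintro _ ⟨i, rfl⟩
    have hi : ‖eigenProj σ b (eigenProj ρ a (someBasis H i))‖ ^ 2 ≤ 0 :=
      ENNReal.ofReal_eq_zero.1 (h i)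
    simpa using hi.antisymm (sq_nonneg _)
  · rw [← ContinuousLinearMap.comp_apply, h]
    simp

theorem spectralOverlap_eq_zero_of_neg_left {ρ : H →L[ℂ] H} (hρ : ρ.IsPositive)
    (σ : H →L[ℂ] H) {a : ℝ} (ha : a < 0) (b : ℝ) : spectralOverlap ρ σ a b = 0 := by
  rw [spectralOverlap_eq_zero_iff, eigenProj_eq_zero_of_neg hρ ha, ContinuousLinearMap.comp_zero]

theorem spectralOverlap_eq_zero_of_neg_right (ρ : H →L[ℂ] H) {σ : H →L[ℂ] H}
    (hσ : σ.IsPositive) (a : ℝ) {b : ℝ} (hb : b < 0) : spectralOverlap ρ σ a b = 0 := by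
  rw [spectralOverlap_eq_zero_iff, eigenProj_eq_zero_of_neg hσ hb, ContinuousLinearMap.zero_comp]

theorem eq_of_spectralOverlap_eq_zero {ρ σ : H →L[ℂ] H} (hcρ : IsCompactOperator ρ)
    (hρ : ρ.IsSymmetric) (hcσ : IsCompactOperator σ) (hσ : σ.IsSymmetric)
    (h : ∀ a b, a ≠ b → spectralOverlap ρ σ a b = 0) : ρ = σ := by
  have hfix (a : ℝ) (x : H) : eigenProj σ a (eigenProj ρ a x) = eigenProj ρ a x := by
    refine (hasSum_single a fun b hb => ?_).unique (hasSum_eigenProj hcσ hσ (eigenProj ρ a x))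
    exact DFunLike.congr_fun (spectralOverlap_eq_zero_iff.1 (h a b hb.symm)) x
  ext x
  have hx := hasSum_eigenProj hcρ hρ x
  refine (hx.mapL ρ).unique ?_
  simpa only [apply_eigenProj, eigenProj_eq_self_iff.1 (hfix _ x)] using hx.mapL σ

/-- The sum of `f a b` over all pairs `(a, b)`, weighted by `Tr (P_a Q_b)` for the spectral
projections `P_a` of `ρ` and `Q_b` of `σ`. Both parts of `relativeEntropy` are of this form. -/
noncomputable def overlapSum (ρ σ : H →L[ℂ] H) (f : ℝ → ℝ → ℝ≥0∞) : ℝ≥0∞ :=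
  ∑' (a : ℝ) (b : ℝ), spectralOverlap ρ σ a b * f a b

theorem overlapSum_add (ρ σ : H →L[ℂ] H) (f g : ℝ → ℝ → ℝ≥0∞) :
    overlapSum ρ σ (f + g) = overlapSum ρ σ f + overlapSum ρ σ g := by
  simp only [overlapSum, Pi.add_apply, mul_add, ENNReal.tsum_add]

theorem overlapSum_swap (ρ σ : H →L[ℂ] H) (f : ℝ → ℝ → ℝ≥0∞) :
    overlapSum σ ρ (Function.swap f) = overlapSum ρ σ f := by
  simp only [overlapSum, Function.swap, spectralOverlap_comm σ ρ]
  exact ENNReal.tsum_comm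

theorem overlapSum_left {ρ σ : H →L[ℂ] H} (hcρ : IsCompactOperator ρ) (hρ : ρ.IsPositive)
    (hcσ : IsCompactOperator σ) (hσ : σ.IsSymmetric) :
    overlapSum ρ σ (fun a _ => ENNReal.ofReal a) = posTrace ρ :=
  calc overlapSum ρ σ (fun a _ => ENNReal.ofReal a)
      = ∑' a : ℝ, (∑' i, ENNReal.ofReal (‖eigenProj ρ a (someBasis H i)‖ ^ 2)) *
          ENNReal.ofReal a := by
        simp only [overlapSum, ENNReal.tsum_mul_right, spectralOverlap_eq_tsum]
        simp only [ENNReal.tsum_comm (α := ℝ) (β := basisIndex H),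
          tsum_ofReal_sq_norm_eigenProj hcσ hσ]
    _ = ∑' i, ∑' a : ℝ, ENNReal.ofReal (‖eigenProj ρ a (someBasis H i)‖ ^ 2) *
          ENNReal.ofReal a := by
        simp only [← ENNReal.tsum_mul_right]
        exact ENNReal.tsum_comm
    _ = posTrace ρ := by simp only [tsum_ofReal_sq_norm_eigenProj_mul hcρ hρ, posTrace]

theorem overlapSum_right {ρ σ : H →L[ℂ] H} (hcρ : IsCompactOperator ρ) (hρ : ρ.IsSymmetric)
    (hcσ : IsCompactOperator σ) (hσ : σ.IsPositive) :
    overlapSum ρ σ (fun _ b => ENNReal.ofReal b) = posTrace σ := by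
  rw [← overlapSum_swap]
  exact overlapSum_left hcσ hσ hcρ hρ

section Monotone

variable {ρ σ : H →L[ℂ] H} {f g : ℝ → ℝ → ℝ≥0∞}

theorem spectralOverlap_mul_le (hρ : ρ.IsPositive) (hσ : σ.IsPositive)
    (hfg : ∀ a b, 0 ≤ a → 0 ≤ b → f a b ≤ g a b) (a b : ℝ) :
    spectralOverlap ρ σ a b * f a b ≤ spectralOverlap ρ σ a b * g a b := by
  rcases lt_or_ge a 0 with ha | ha
  · simp [spectralOverlap_eq_zero_of_neg_left hρ σ ha]
  rcases lt_or_ge b 0 with hb | hb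
  · simp [spectralOverlap_eq_zero_of_neg_right ρ hσ a hb]
  gcongr
  exact hfg a b ha hb

theorem overlapSum_mono (hρ : ρ.IsPositive) (hσ : σ.IsPositive)
    (hfg : ∀ a b, 0 ≤ a → 0 ≤ b → f a b ≤ g a b) : overlapSum ρ σ f ≤ overlapSum ρ σ g :=
  ENNReal.tsum_le_tsum fun a => ENNReal.tsum_le_tsum (spectralOverlap_mul_le hρ hσ hfg a)

theorem spectralOverlap_eq_zero_of_overlapSum_le (hρ : ρ.IsPositive) (hσ : σ.IsPositive)
    (hfg : ∀ a b, 0 ≤ a → 0 ≤ b → f a b ≤ g a b) (hle : overlapSum ρ σ g ≤ overlapSum ρ σ f)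
    (hfin : overlapSum ρ σ f ≠ ⊤) {a b : ℝ} (hlt : 0 ≤ a → 0 ≤ b → f a b < g a b) :
    spectralOverlap ρ σ a b = 0 := by
  by_contra hw
  have ha : 0 ≤ a := le_of_not_gt fun ha => hw (spectralOverlap_eq_zero_of_neg_left hρ σ ha b)
  have hb : 0 ≤ b := le_of_not_gt fun hb => hw (spectralOverlap_eq_zero_of_neg_right ρ hσ a hb)
  have hfin_term : spectralOverlap ρ σ a b * g a b ≠ ⊤ :=
    ENNReal.ne_top_of_tsum_ne_top (ENNReal.ne_top_of_tsum_ne_top (ne_top_of_le_ne_top hfin hle) a) b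
  have hw_top : spectralOverlap ρ σ a b ≠ ⊤ := fun htop =>
    hfin_term (by rw [htop, ENNReal.top_mul (hlt ha hb).ne_bot])
  simp only [overlapSum, ← ENNReal.tsum_prod] at hle hfin
  refine (ENNReal.tsum_lt_tsum (i := (a, b)) hfin (fun p => ?_) ?_).not_ge hle
  · exact spectralOverlap_mul_le hρ hσ hfg p.1 p.2
  · exact ENNReal.mul_lt_mul_right hw hw_top (hlt ha hb)

end Monotone

end Overlap

section EntropyTerm

variable {a b : ℝ}

theorem sub_lt_mul_log_sub_log (ha : 0 < a) (hb : 0 < b) (hab : a ≠ b) :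
    a - b < a * (Real.log a - Real.log b) := by
  have hlog : Real.log (b / a) < b / a - 1 :=
    Real.log_lt_sub_one_of_pos (by positivity) (by rwa [Ne, div_eq_one_iff_eq ha.ne', eq_comm])
  calc a - b = a * -(b / a - 1) := by field_simp; ring
    _ < a * -Real.log (b / a) := by gcongr
    _ = a * (Real.log a - Real.log b) := by rw [Real.log_div hb.ne' ha.ne', neg_sub]

/-- The positive part of `entropyTerm`. -/
noncomputable def entropyPosPart (a b : ℝ) : ℝ≥0∞ := (entropyTerm a b).toENNReal

/-- The negative part of `entropyTerm`. -/
noncomputable def entropyNegPart (a b : ℝ) : ℝ≥0∞ := (-entropyTerm a b).toENNReal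

theorem entropyTerm_self (a : ℝ) : entropyTerm a a = 0 := by
  unfold entropyTerm
  split_ifs <;> simp

theorem entropyNegPart_add_lt (ha : 0 ≤ a) (hb : 0 ≤ b) (hab : a ≠ b) :
    entropyNegPart a b + ENNReal.ofReal a < entropyPosPart a b + ENNReal.ofReal b := by
  unfold entropyNegPart entropyPosPart entropyTerm
  split_ifs with ha0 hb0
  · subst ha0
    simpa using hb.lt_of_ne hab
  · simp
  · have hb' : 0 < b := hb.lt_of_ne' hb0
    have hlt := sub_lt_mul_log_sub_log (ha.lt_of_ne' ha0) hb' hab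
    set t := a * (Real.log a - Real.log b)
    rw [← EReal.coe_neg, EReal.toENNReal_of_ne_top (EReal.coe_ne_top _),
      EReal.toENNReal_of_ne_top (EReal.coe_ne_top _), EReal.toReal_coe, EReal.toReal_coe]
    rcases le_total 0 t with ht | ht
    · rw [ENNReal.ofReal_of_nonpos (neg_nonpos.2 ht), zero_add, ← ENNReal.ofReal_add ht hb]
      exact (ENNReal.ofReal_lt_ofReal_iff (by positivity)).2 (by linarith)
    · rw [ENNReal.ofReal_of_nonpos ht, zero_add, ← ENNReal.ofReal_add (neg_nonneg.2 ht) ha]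
      exact (ENNReal.ofReal_lt_ofReal_iff hb').2 (by linarith)

theorem entropyNegPart_add_le (ha : 0 ≤ a) (hb : 0 ≤ b) :
    entropyNegPart a b + ENNReal.ofReal a ≤ entropyPosPart a b + ENNReal.ofReal b := by
  rcases eq_or_ne a b with rfl | hab
  · simp [entropyNegPart, entropyPosPart, entropyTerm_self]
  · exact (entropyNegPart_add_lt ha hb hab).le

theorem entropyNegPart_le (ha : 0 ≤ a) (hb : 0 ≤ b) : entropyNegPart a b ≤ ENNReal.ofReal b := by
  rcases le_total 0 (entropyTerm a b) with h | h
  · simp [entropyNegPart, EReal.toENNReal_of_nonpos (EReal.neg_le_zero.2 h)]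
  · refine le_self_add.trans ((entropyNegPart_add_le ha hb).trans_eq ?_)
    simp [entropyPosPart, EReal.toENNReal_of_nonpos h]

end EntropyTerm

section Klein

variable {H : Type*} [NormedAddCommGroup H] [InnerProductSpace ℂ H] [CompleteSpace H]
  {ρ σ : H →L[ℂ] H}

theorem relativeEntropy_eq_overlapSum_sub (ρ σ : H →L[ℂ] H) :
    relativeEntropy ρ σ =
      (overlapSum ρ σ entropyPosPart : EReal) - (overlapSum ρ σ entropyNegPart : EReal) :=
  rfl

theorem overlapSum_entropyNegPart_le (hcρ : IsCompactOperator ρ) (hρ : ρ.IsPositive)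
    (hcσ : IsCompactOperator σ) (hσ : σ.IsPositive) :
    overlapSum ρ σ entropyNegPart ≤ posTrace σ := by
  rw [← overlapSum_right hcρ hρ.isSymmetric hcσ hσ]
  exact overlapSum_mono hρ hσ fun _ _ => entropyNegPart_le

theorem overlapSum_entropyNegPart_add (hcρ : IsCompactOperator ρ) (hρ : ρ.IsPositive)
    (hcσ : IsCompactOperator σ) (hσ : σ.IsSymmetric) :
    overlapSum ρ σ (entropyNegPart + fun a _ => ENNReal.ofReal a) =
      overlapSum ρ σ entropyNegPart + posTrace ρ := by
  rw [overlapSum_add, overlapSum_left hcρ hρ hcσ hσ]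

theorem overlapSum_entropyPosPart_add (hcρ : IsCompactOperator ρ) (hρ : ρ.IsSymmetric)
    (hcσ : IsCompactOperator σ) (hσ : σ.IsPositive) :
    overlapSum ρ σ (entropyPosPart + fun _ b => ENNReal.ofReal b) =
      overlapSum ρ σ entropyPosPart + posTrace σ := by
  rw [overlapSum_add, overlapSum_right hcρ hρ hcσ hσ]

theorem overlapSum_entropyNegPart_add_posTrace_le (hcρ : IsCompactOperator ρ)
    (hρ : ρ.IsPositive) (hcσ : IsCompactOperator σ) (hσ : σ.IsPositive) :
    overlapSum ρ σ entropyNegPart + posTrace ρ ≤ overlapSum ρ σ entropyPosPart + posTrace σ := by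
  rw [← overlapSum_entropyNegPart_add hcρ hρ hcσ hσ.isSymmetric,
    ← overlapSum_entropyPosPart_add hcρ hρ.isSymmetric hcσ hσ]
  exact overlapSum_mono hρ hσ fun _ _ => entropyNegPart_add_le

theorem eq_of_overlapSum_entropyPosPart_add_posTrace_le (hcρ : IsCompactOperator ρ)
    (hρ : ρ.IsPositive) (hcσ : IsCompactOperator σ) (hσ : σ.IsPositive)
    (hfin : overlapSum ρ σ entropyNegPart + posTrace ρ ≠ ⊤)
    (hle : overlapSum ρ σ entropyPosPart + posTrace σ ≤
      overlapSum ρ σ entropyNegPart + posTrace ρ) : ρ = σ := by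
  rw [← overlapSum_entropyNegPart_add hcρ hρ hcσ hσ.isSymmetric] at hfin hle
  rw [← overlapSum_entropyPosPart_add hcρ hρ.isSymmetric hcσ hσ] at hle
  exact eq_of_spectralOverlap_eq_zero hcρ hρ.isSymmetric hcσ hσ.isSymmetric fun a b hab =>
    spectralOverlap_eq_zero_of_overlapSum_le hρ hσ (fun _ _ => entropyNegPart_add_le) hle hfin
      fun ha hb => entropyNegPart_add_lt ha hb hab

theorem relativeEntropy_nonneg (hρ : ρ.IsPositive) (hσ : σ.IsPositive) (hfin : posTrace ρ ≠ ⊤)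
    (hle : posTrace σ ≤ posTrace ρ) : 0 ≤ relativeEntropy ρ σ := by
  have hfinσ : posTrace σ ≠ ⊤ := ne_top_of_le_ne_top hfin hle
  have hcρ := isCompactOperator_of_posTrace_ne_top hρ hfin
  have hcσ := isCompactOperator_of_posTrace_ne_top hσ hfinσ
  have hneg : overlapSum ρ σ entropyNegPart ≠ ⊤ :=
    ne_top_of_le_ne_top hfinσ (overlapSum_entropyNegPart_le hcρ hρ hcσ hσ)
  have hparts : overlapSum ρ σ entropyNegPart ≤ overlapSum ρ σ entropyPosPart :=
    (ENNReal.add_le_add_iff_right hfin).1 <|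
      (overlapSum_entropyNegPart_add_posTrace_le hcρ hρ hcσ hσ).trans (by gcongr)
  rw [relativeEntropy_eq_overlapSum_sub]
  exact (EReal.sub_nonneg (by simp [hneg]) (by simp)).2
    (EReal.coe_ennreal_le_coe_ennreal_iff.2 hparts)

theorem relativeEntropy_self (hρ : ρ.IsSymmetric) : relativeEntropy ρ ρ = 0 := by
  have hzero (f : ℝ → ℝ → ℝ≥0∞) (hf : ∀ a, f a a = 0) : overlapSum ρ ρ f = 0 := by
    refine ENNReal.tsum_eq_zero.2 fun a => ENNReal.tsum_eq_zero.2 fun b => ?_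
    rcases eq_or_ne a b with rfl | hab
    · rw [hf, mul_zero]
    · rw [spectralOverlap_eq_zero_iff.2 (ContinuousLinearMap.ext
        (eigenProj_eigenProj_of_ne hρ hab)), zero_mul]
  rw [relativeEntropy_eq_overlapSum_sub, hzero entropyPosPart, hzero entropyNegPart]
  · simp
  · simp [entropyNegPart, entropyTerm_self]
  · simp [entropyPosPart, entropyTerm_self]

theorem relativeEntropy_eq_zero_iff (hρ : ρ.IsPositive) (hσ : σ.IsPositive)
    (hfin : posTrace ρ ≠ ⊤) (hle : posTrace σ ≤ posTrace ρ) :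
    relativeEntropy ρ σ = 0 ↔ ρ = σ := by
  refine ⟨fun h0 => ?_, fun h => h ▸ relativeEntropy_self hρ.isSymmetric⟩
  have hfinσ : posTrace σ ≠ ⊤ := ne_top_of_le_ne_top hfin hle
  have hcρ := isCompactOperator_of_posTrace_ne_top hρ hfin
  have hcσ := isCompactOperator_of_posTrace_ne_top hσ hfinσ
  have hneg : overlapSum ρ σ entropyNegPart ≠ ⊤ :=
    ne_top_of_le_ne_top hfinσ (overlapSum_entropyNegPart_le hcρ hρ hcσ hσ)
  have hparts : overlapSum ρ σ entropyPosPart ≤ overlapSum ρ σ entropyNegPart :=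
    EReal.coe_ennreal_le_coe_ennreal_iff.1 (EReal.sub_nonpos.1 h0.le)
  exact eq_of_overlapSum_entropyPosPart_add_posTrace_le hcρ hρ hcσ hσ
    (ENNReal.add_ne_top.2 ⟨hneg, hfin⟩) (add_le_add hparts hle)

end Klein

/-! ### Dephasing preserves positivity and the trace -/

theorem countable_of_orthonormal {𝕜 ι E : Type*} [RCLike 𝕜] [NormedAddCommGroup E]
    [InnerProductSpace 𝕜 E] [TopologicalSpace.SeparableSpace E] {v : ι → E}
    (hv : Orthonormal 𝕜 v) : Countable ι := by
  have hdist (i j : ι) (hij : i ≠ j) : 1 ≤ dist (v i) (v j) := by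
    have h := norm_sub_sq (𝕜 := 𝕜) (v i) (v j)
    rw [hv.2 hij, hv.1, hv.1, map_zero] at h
    rw [dist_eq_norm]
    nlinarith [norm_nonneg (v i - v j)]
  refine Pairwise.countable_of_isOpen_disjoint (s := fun i => Metric.ball (v i) (1 / 2))
    (fun i j hij => Metric.ball_disjoint_ball ?_) (fun i => Metric.isOpen_ball)
    fun i => Metric.nonempty_ball.2 one_half_pos
  linarith [hdist i j hij]

theorem tsum_re_inner_map_basis {ι H : Type*} [NormedAddCommGroup H] [InnerProductSpace ℂ H]
    [CompleteSpace H] (b : HilbertBasis ι ℂ H) (U : H →ₗᵢ[ℂ] H) (hU : Function.Surjective U)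
    {T : H →L[ℂ] H} (hT : T.IsPositive) :
    ∑' i, ENNReal.ofReal (⟪U (b i), T (U (b i))⟫_ℂ).re = posTrace T := by
  classical
  let Ub := HilbertBasis.ofRepr ((LinearIsometryEquiv.ofSurjective U hU).symm.trans b.repr)
  have hUb (i : ι) : Ub i = U (b i) := by
    rw [← Ub.repr_symm_single, ← b.repr_symm_single]
    rfl
  simp only [posTrace_eq Ub hT, hUb]

theorem momentumKick_momentumKick_neg (ħ p : ℝ) (ψ : L2R) :
    momentumKick ħ p (momentumKick ħ (-p) ψ) = ψ := by
  apply Lp.ext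
  filter_upwards [momentumKick_coeFn ħ p (momentumKick ħ (-p) ψ),
    momentumKick_coeFn ħ (-p) ψ] with x h1 h2
  rw [h1, h2, ← mul_assoc, phase, phase, ← Complex.exp_add, ← add_mul, ← Complex.ofReal_add]
  simp [neg_div]

theorem surjective_momentumKick (ħ p : ℝ) : Function.Surjective (momentumKick ħ p) := fun ψ =>
  ⟨_, momentumKick_momentumKick_neg ħ p ψ⟩

theorem inner_momentumKick (ħ p : ℝ) (φ ψ : L2R) :
    ⟪φ, momentumKick ħ p ψ⟫_ℂ = ⟪momentumKick ħ (-p) φ, ψ⟫_ℂ := by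
  rw [← (momentumKick ħ p).inner_map_map (momentumKick ħ (-p) φ), momentumKick_momentumKick_neg]

section Dephasing

variable (ħ : ℝ) (κ : Measure ℝ) [IsProbabilityMeasure κ] (T : L2R →L[ℂ] L2R)

theorem continuous_inner_kicked (φ ψ : L2R) :
    Continuous fun p => ⟪momentumKick ħ (-p) φ, T (momentumKick ħ (-p) ψ)⟫_ℂ := by
  simp only [← inner_momentumKick]
  exact continuous_const.inner (continuous_kicked ħ T ψ)

theorem integrable_inner_kicked (φ ψ : L2R) :
    Integrable (fun p => ⟪momentumKick ħ (-p) φ, T (momentumKick ħ (-p) ψ)⟫_ℂ) κ := by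
  simp only [← inner_momentumKick]
  exact (integrable_kicked ħ κ T ψ).const_inner φ

theorem inner_dephasing (φ ψ : L2R) :
    ⟪φ, dephasing ħ κ T ψ⟫_ℂ =
      ∫ p, ⟪momentumKick ħ (-p) φ, T (momentumKick ħ (-p) ψ)⟫_ℂ ∂κ := by
  simp only [← inner_momentumKick]
  exact (integral_inner (integrable_kicked ħ κ T ψ) φ).symm

theorem re_inner_dephasing (ψ : L2R) :
    (⟪ψ, dephasing ħ κ T ψ⟫_ℂ).re =
      ∫ p, (⟪momentumKick ħ (-p) ψ, T (momentumKick ħ (-p) ψ)⟫_ℂ).re ∂κ := by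
  rw [inner_dephasing]
  exact (integral_re (integrable_inner_kicked ħ κ T ψ ψ)).symm

variable {T}

theorem isSymmetric_dephasing (hT : T.IsSymmetric) : (dephasing ħ κ T).IsSymmetric := fun ψ φ =>
  calc ⟪dephasing ħ κ T ψ, φ⟫_ℂ
      = ∫ p, (starRingEnd ℂ) ⟪momentumKick ħ (-p) φ, T (momentumKick ħ (-p) ψ)⟫_ℂ ∂κ := by
        rw [← inner_conj_symm, inner_dephasing, integral_conj]
    _ = ∫ p, ⟪momentumKick ħ (-p) ψ, T (momentumKick ħ (-p) φ)⟫_ℂ ∂κ := by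
        simp only [inner_conj_symm]
        exact integral_congr_ae (Eventually.of_forall fun p => hT _ _)
    _ = ⟪ψ, dephasing ħ κ T φ⟫_ℂ := (inner_dephasing ħ κ T ψ φ).symm

theorem isPositive_dephasing (hT : T.IsPositive) : (dephasing ħ κ T).IsPositive := by
  refine ⟨isSymmetric_dephasing ħ κ hT.isSymmetric, fun ψ => ?_⟩
  rw [ContinuousLinearMap.reApplyInnerSelf_apply, inner_re_symm, RCLike.re_to_complex,
    re_inner_dephasing]
  exact integral_nonneg fun p => hT.re_inner_nonneg_right _

theorem ofReal_re_inner_dephasing (hT : T.IsPositive) (ψ : L2R) :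
    ENNReal.ofReal (⟪ψ, dephasing ħ κ T ψ⟫_ℂ).re =
      ∫⁻ p, ENNReal.ofReal (⟪momentumKick ħ (-p) ψ, T (momentumKick ħ (-p) ψ)⟫_ℂ).re ∂κ := by
  rw [re_inner_dephasing]
  exact ofReal_integral_eq_lintegral_ofReal (integrable_inner_kicked ħ κ T ψ ψ).re
    (Eventually.of_forall fun p => hT.re_inner_nonneg_right _)

theorem posTrace_dephasing (hT : T.IsPositive) : posTrace (dephasing ħ κ T) = posTrace T := by
  have : Fact ((2 : ℝ≥0∞) ≠ ⊤) := ⟨ENNReal.ofNat_ne_top⟩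
  have : Countable (basisIndex L2R) := countable_of_orthonormal (someBasis L2R).orthonormal
  have hmeas (ψ : L2R) : Measurable fun p =>
      ENNReal.ofReal (⟪momentumKick ħ (-p) ψ, T (momentumKick ħ (-p) ψ)⟫_ℂ).re :=
    (Complex.continuous_re.comp (continuous_inner_kicked ħ T ψ ψ)).measurable.ennreal_ofReal
  calc posTrace (dephasing ħ κ T)
      = ∑' i, ∫⁻ p, ENNReal.ofReal (⟪momentumKick ħ (-p) (someBasis L2R i),
          T (momentumKick ħ (-p) (someBasis L2R i))⟫_ℂ).re ∂κ := by
        simp only [posTrace, ofReal_re_inner_dephasing ħ κ hT]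
    _ = ∫⁻ p, ∑' i, ENNReal.ofReal (⟪momentumKick ħ (-p) (someBasis L2R i),
          T (momentumKick ħ (-p) (someBasis L2R i))⟫_ℂ).re ∂κ :=
        (lintegral_tsum fun i => (hmeas _).aemeasurable).symm
    _ = ∫⁻ _, posTrace T ∂κ := by
        simp only [tsum_re_inner_map_basis _ _ (surjective_momentumKick ħ _) hT]
    _ = posTrace T := by simp

end Dephasing

theorem dephasing_dirac_zero (ħ : ℝ) (T : L2R →L[ℂ] L2R) :
    dephasing ħ (Measure.dirac 0) T = T := by
  have hkick (ψ : L2R) : momentumKick ħ 0 ψ = ψ := by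
    apply Lp.ext
    filter_upwards [momentumKick_coeFn ħ 0 ψ] with x hx
    simp [hx, phase]
  ext1 ψ
  change ∫ p, momentumKick ħ p (T (momentumKick ħ (-p) ψ)) ∂Measure.dirac 0 = T ψ
  rw [integral_dirac, neg_zero, hkick, hkick]

theorem dephasingFunction_dirac_zero (ħ ξ : ℝ) :
    dephasingFunction ħ (Measure.dirac 0) ξ = 1 := by
  simp [dephasingFunction, phase]

/-! ### Operators fixed by dephasing -/

section NormEigenspace

variable {H : Type*} [NormedAddCommGroup H] [InnerProductSpace ℂ H] {T : H →L[ℂ] H}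

theorem re_inner_apply_le_opNorm_mul_sq (T : H →L[ℂ] H) (x : H) :
    (⟪x, T x⟫_ℂ).re ≤ ‖T‖ * ‖x‖ ^ 2 :=
  calc (⟪x, T x⟫_ℂ).re ≤ ‖x‖ * ‖T x‖ := re_inner_le_norm (𝕜 := ℂ) x (T x)
    _ ≤ ‖x‖ * (‖T‖ * ‖x‖) := by gcongr; exact T.le_opNorm x
    _ = ‖T‖ * ‖x‖ ^ 2 := by ring

theorem mem_realEigenspace_opNorm_iff {x : H} :
    x ∈ realEigenspace T ‖T‖ ↔ (⟪x, T x⟫_ℂ).re = ‖T‖ * ‖x‖ ^ 2 := by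
  rw [mem_realEigenspace]
  refine ⟨fun h => ?_, fun h => ?_⟩
  · rw [h, inner_smul_right, Complex.re_ofReal_mul, ← RCLike.re_to_complex,
      inner_self_eq_norm_sq (𝕜 := ℂ)]
  have hcross : RCLike.re ⟪T x, (‖T‖ : ℂ) • x⟫_ℂ = ‖T‖ * (‖T‖ * ‖x‖ ^ 2) := by
    rw [← h, inner_re_symm, inner_smul_left, Complex.conj_ofReal]
    exact Complex.re_ofReal_mul _ _
  have hTx : ‖T x‖ ^ 2 ≤ (‖T‖ * ‖x‖) ^ 2 := by gcongr; exact T.le_opNorm x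
  have hsq : ‖T x - (‖T‖ : ℂ) • x‖ ^ 2 ≤ 0 := by
    rw [norm_sub_sq (𝕜 := ℂ), hcross, norm_smul, Complex.norm_real, norm_norm]
    linarith
  rw [← sub_eq_zero, ← norm_eq_zero]
  exact pow_eq_zero_iff two_ne_zero |>.1 (le_antisymm hsq (sq_nonneg _))

theorem ae_mem_realEigenspace_opNorm {Ω : Type*} [MeasurableSpace Ω] {μ : Measure Ω}
    [IsProbabilityMeasure μ] {v : Ω → H} {r : ℝ} (hv : ∀ ω, ‖v ω‖ = r)
    (hint : Integrable (fun ω => (⟪v ω, T (v ω)⟫_ℂ).re) μ)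
    (heq : ∫ ω, (⟪v ω, T (v ω)⟫_ℂ).re ∂μ = ‖T‖ * r ^ 2) :
    ∀ᵐ ω ∂μ, v ω ∈ realEigenspace T ‖T‖ := by
  have hle (ω : Ω) : (⟪v ω, T (v ω)⟫_ℂ).re ≤ ‖T‖ * r ^ 2 :=
    hv ω ▸ re_inner_apply_le_opNorm_mul_sq T (v ω)
  have hdefect : ∫ ω, ‖T‖ * r ^ 2 - (⟪v ω, T (v ω)⟫_ℂ).re ∂μ = 0 := by
    rw [integral_sub (integrable_const _) hint, integral_const, probReal_univ, one_smul, heq,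
      sub_self]
  have hae := (integral_eq_zero_iff_of_nonneg (fun ω => sub_nonneg.2 (hle ω))
    ((integrable_const _).sub hint)).1 hdefect
  filter_upwards [hae] with ω hω
  rw [mem_realEigenspace_opNorm_iff, hv]
  exact (sub_eq_zero.1 hω).symm

theorem realEigenspace_opNorm_ne_bot [CompleteSpace H] (hc : IsCompactOperator T)
    (hT : T.IsPositive) (h0 : T ≠ 0) : realEigenspace T ‖T‖ ≠ ⊥ := by
  have : Nontrivial (H →L[ℂ] H) := ⟨T, 0, h0⟩
  have hspec : ‖T‖ ∈ spectrum ℝ T :=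
    CStarAlgebra.norm_mem_spectrum_of_nonneg (T.nonneg_iff_isPositive.2 hT)
  have heig : Module.End.HasEigenvalue (T : Module.End ℂ H) (‖T‖ : ℂ) := by
    rw [hc.hasEigenvalue_iff_mem_spectrum (by simpa using h0)]
    exact (spectrum.algebraMap_mem_iff ℂ).2 hspec
  rw [realEigenspace_eq_eigenspace]
  exact heig

theorem finiteDimensional_realEigenspace [CompleteSpace H] (hc : IsCompactOperator T) {a : ℝ}
    (ha : a ≠ 0) : FiniteDimensional ℂ (realEigenspace T a) := by
  rw [realEigenspace_eq_eigenspace]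
  exact ContinuousLinearMap.finite_dimensional_eigenspace hc _ (Complex.ofReal_ne_zero.2 ha)

end NormEigenspace

theorem ae_forall_mem_of_forall_ae_mem {Ω R M N : Type*} [MeasurableSpace Ω] {μ : Measure Ω}
    [Semiring R] [AddCommMonoid M] [Module R M] [AddCommMonoid N] [Module R N]
    {E : Submodule R M} (hE : E.FG) {F : Submodule R N} {U : Ω → M →ₗ[R] N}
    (h : ∀ x ∈ E, ∀ᵐ ω ∂μ, U ω x ∈ F) : ∀ᵐ ω ∂μ, ∀ x ∈ E, U ω x ∈ F := by
  obtain ⟨s, rfl⟩ := hE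
  have hs : ∀ᵐ ω ∂μ, ∀ x ∈ s, U ω x ∈ F :=
    (ae_ball_iff s.countable_toSet).2 fun x hx => h x (Submodule.subset_span hx)
  filter_upwards [hs] with ω hω
  exact Submodule.span_le (p := F.comap (U ω)).2 hω

theorem exists_eigenvector_of_invariant {𝕜 V : Type*} [Field 𝕜] [IsAlgClosed 𝕜] [AddCommGroup V]
    [Module 𝕜 V] {E : Submodule 𝕜 V} [FiniteDimensional 𝕜 E] (hE : E ≠ ⊥) {f : V →ₗ[𝕜] V}
    (hf : ∀ x ∈ E, f x ∈ E) : ∃ (c : 𝕜) (x : V), x ≠ 0 ∧ f x = c • x := by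
  have : Nontrivial E := Submodule.nontrivial_iff_ne_bot.2 hE
  obtain ⟨c, hc⟩ := Module.End.exists_eigenvalue (f.restrict hf)
  obtain ⟨x, hx⟩ := hc.exists_hasEigenvector
  exact ⟨c, x, Subtype.coe_injective.ne hx.2, congrArg Subtype.val hx.apply_eq_smul⟩

theorem eq_dirac_of_ae_eq {Ω : Type*} [MeasurableSpace Ω] {μ : Measure Ω}
    [IsProbabilityMeasure μ] {a : Ω} (h : ∀ᵐ ω ∂μ, ω = a) :
    μ = Measure.dirac a := by
  have hid : (id : Ω → Ω) =ᵐ[μ] fun _ => a := h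
  simpa using Measure.map_congr hid

theorem countable_setOf_phase_eq {ħ p : ℝ} (hħ : ħ ≠ 0) (hp : p ≠ 0) (c : ℂ) :
    {x | phase ħ p x = c}.Countable := by
  rcases Set.eq_empty_or_nonempty {x | phase ħ p x = c} with hempty | ⟨y, hy⟩
  · rw [hempty]
    exact Set.countable_empty
  refine (Set.countable_range fun n : ℤ => y + n * (2 * Real.pi) * ħ / p).mono fun x hx => ?_
  obtain ⟨n, hn⟩ := Complex.exp_eq_exp_iff_exists_int.1
    (show phase ħ p x = phase ħ p y from hx.trans hy.symm)
  have hexponent : ((p * x / ħ : ℝ) : ℂ) * Complex.I =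
      ((p * y / ħ + n * (2 * Real.pi) : ℝ) : ℂ) * Complex.I := by
    rw [hn]
    push_cast
    ring
  have hangle : p * x / ħ = p * y / ħ + n * (2 * Real.pi) := by
    exact_mod_cast mul_right_cancel₀ Complex.I_ne_zero hexponent
  refine ⟨n, ?_⟩
  field_simp at hangle ⊢
  linarith

theorem eq_zero_of_momentumKick_eq_smul {ħ p : ℝ} (hħ : ħ ≠ 0) (hp : p ≠ 0) {c : ℂ}
    {ψ : L2R} (h : momentumKick ħ p ψ = c • ψ) : ψ = 0 := by
  rw [Lp.eq_zero_iff_ae_eq_zero]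
  have hphase : ∀ᵐ x : ℝ, phase ħ p x ≠ c := (countable_setOf_phase_eq hħ hp c).ae_notMem volume
  have hkick := momentumKick_coeFn ħ p ψ
  rw [h] at hkick
  filter_upwards [hphase, hkick, Lp.coeFn_smul c ψ] with x hx hkickx hsmul
  rw [hsmul, Pi.smul_apply, smul_eq_mul, mul_eq_mul_right_iff] at hkickx
  exact hkickx.resolve_left hx.symm

theorem eq_zero_of_forall_momentumKick_mem {ħ p : ℝ} (hħ : ħ ≠ 0) {E : Submodule ℂ L2R}
    [FiniteDimensional ℂ E] (hE : E ≠ ⊥) (hp : ∀ ψ ∈ E, momentumKick ħ p ψ ∈ E) : p = 0 := by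
  by_contra hp0
  obtain ⟨c, ψ, hψ, hc⟩ :=
    exists_eigenvector_of_invariant hE (f := (momentumKick ħ p).toLinearMap) hp
  exact hψ (eq_zero_of_momentumKick_eq_smul hħ hp0 hc)

section FixedPoints

variable {ħ : ℝ} {κ : Measure ℝ} [IsProbabilityMeasure κ] {T : L2R →L[ℂ] L2R}

theorem ae_momentumKick_mem_realEigenspace_opNorm (hfix : dephasing ħ κ T = T) {ψ : L2R}
    (hψ : ψ ∈ realEigenspace T ‖T‖) :
    ∀ᵐ p ∂κ, momentumKick ħ (-p) ψ ∈ realEigenspace T ‖T‖ := by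
  refine ae_mem_realEigenspace_opNorm (fun p => (momentumKick ħ (-p)).norm_map ψ)
    (integrable_inner_kicked ħ κ T ψ ψ).re ?_
  calc ∫ p, (⟪momentumKick ħ (-p) ψ, T (momentumKick ħ (-p) ψ)⟫_ℂ).re ∂κ
      = (⟪ψ, T ψ⟫_ℂ).re := by rw [← re_inner_dephasing, hfix]
    _ = ‖T‖ * ‖ψ‖ ^ 2 := mem_realEigenspace_opNorm_iff.1 hψ

theorem dephasing_eq_self_iff (hħ : ħ ≠ 0) (hc : IsCompactOperator T) (hT : T.IsPositive)
    (h0 : T ≠ 0) : dephasing ħ κ T = T ↔ κ = Measure.dirac 0 := by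
  refine ⟨fun hfix => eq_dirac_of_ae_eq ?_, ?_⟩
  · have : FiniteDimensional ℂ (realEigenspace T ‖T‖) :=
      finiteDimensional_realEigenspace hc (norm_ne_zero_iff.2 h0)
    have hinvariant : ∀ᵐ p ∂κ, ∀ ψ ∈ realEigenspace T ‖T‖,
        (momentumKick ħ (-p)).toLinearMap ψ ∈ realEigenspace T ‖T‖ :=
      ae_forall_mem_of_forall_ae_mem (Module.Finite.iff_fg.1 this) fun ψ hψ =>
        ae_momentumKick_mem_realEigenspace_opNorm hfix hψ
    filter_upwards [hinvariant] with p hp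
    exact neg_eq_zero.1 (eq_zero_of_forall_momentumKick_mem hħ
      (realEigenspace_opNorm_ne_bot hc hT h0) hp)
  · rintro rfl
    exact dephasing_dirac_zero ħ T

end FixedPoints

end QuantumCoherence

open QuantumCoherence in
theorem mainTheorem9_general {ħ : ℝ} (hħ : ħ ≠ 0) {κ : Measure ℝ} [IsProbabilityMeasure κ]
    {ρ : L2R →L[ℂ] L2R} (hρ : IsNormalState ρ) :
    0 ≤ relEntropyLoss ħ κ ρ ∧ (relEntropyLoss ħ κ ρ = 0 ↔ κ = Measure.dirac 0) := by
  have hΔ := isPositive_dephasing ħ κ hρ.1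
  have htrace := posTrace_dephasing ħ κ hρ.1
  have hfin : posTrace ρ ≠ ⊤ := by simp [hρ.2]
  refine ⟨relativeEntropy_nonneg hρ.1 hΔ hfin htrace.le, ?_⟩
  rw [relEntropyLoss, relativeEntropy_eq_zero_iff hρ.1 hΔ hfin htrace.le, eq_comm,
    dephasing_eq_self_iff hħ hρ.isCompactOperator hρ.1 hρ.ne_zero]

theorem mainTheorem9 (ħ : ℝ) (hħ : 0 < ħ)
    (κ : MeasureTheory.Measure ℝ) [MeasureTheory.IsProbabilityMeasure κ] :
    (∀ ρ : QuantumCoherence.L2R →L[ℂ] QuantumCoherence.L2R,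
      QuantumCoherence.IsNormalState ρ → 0 ≤ QuantumCoherence.relEntropyLoss ħ κ ρ) ∧
    ((∀ ξ : ℝ, ξ ≠ 0 → ‖QuantumCoherence.dephasingFunction ħ κ ξ‖ < 1) →
      ¬ ∃ ρ : QuantumCoherence.L2R →L[ℂ] QuantumCoherence.L2R,
        QuantumCoherence.IsNormalState ρ ∧ QuantumCoherence.relEntropyLoss ħ κ ρ = 0) := by
  refine ⟨fun ρ hρ => (mainTheorem9_general hħ.ne' hρ).1, ?_⟩
  rintro hg ⟨ρ, hρ, hloss⟩
  obtain rfl := (mainTheorem9_general hħ.ne' hρ).2.1 hloss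
  simpa [QuantumCoherence.dephasingFunction_dirac_zero] using hg 1 one_ne_zero
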